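/- Two players, the cops and the robber, play on a finite graph $G$. First $k$ cops choose initial vertices (several cops may share a vertex), then the robber, seeing them, chooses his initial vertex. Then rounds are played, with perfect information. In each round first every cop stays at her vertex or moves to a neighbouring vertex, and then the robber moves along a path of $G$ of arbitrary length (possibly $0$), no vertex of which is occupied by a cop. The cops win if at some moment a cop occupies the same vertex as the robber; the robber wins if he evades this forever. The infinite-speed cop number $c_\infty(G)$ is the minimum $k$ such that $k$ cops can guarantee to win, no matter how the robber plays. Let $Q_n$ denote the $n$-dimensional hypercube, the graph whose vertices are the $n$-bit binary strings, two of them being adjacent if and only if they differ in exactly one bit. **Theorem.** For all sufficiently large $n$, $$c_\infty(Q_n) \ge \frac{2^{n-3}}{n \ln n}.$$ -/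

import Mathlib

/-- The hypercube `Q_n`: vertices are the `n`-bit binary strings, and two of them are adjacent if
and only if they differ in exactly one bit. -/
def hypercube (n : ℕ) : SimpleGraph (Fin n → Bool) where
  Adj x y := hammingDist x y = 1
  symm := ⟨fun x y h => by rw [hammingDist_comm]; exact h⟩
  loopless := ⟨fun x h => by simp at h⟩

namespace InfiniteSpeedGame

variable {V : Type*}

/-- A strategy for `k` cops on `G`, with perfect information and unbounded memory. `pos h` lists
the cops' vertices when the robber has so far occupied the vertices in `h`, the most recent one
first: `pos []` is the initial placement of the cops, and `pos (v :: h)` is their placement after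
they have answered the robber's choice of `v`. Several cops may share a vertex, and on a cop turn
each cop stays where she is or moves to a neighbour. (Since a strategy is deterministic, the
robber's past determines that of the cops.) -/
structure CopStrategy (G : SimpleGraph V) (k : ℕ) where
  pos : List V → Fin k → V
  legal : ∀ (h : List V) (v : V) (i : Fin k),
    pos (v :: h) i = pos h i ∨ G.Adj (pos h i) (pos (v :: h) i)

/-- `history r t = [r (t - 1), …, r 1, r 0]`, the first `t` positions of the robber, the most
recent one first. -/
def history (r : ℕ → V) : ℕ → List V
  | 0 => []
  | t + 1 => r t :: history r t

/-- The cops' positions after `t` cop turns, when they follow `σ` and the robber's successive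
positions are `r 0` (his initial position, chosen after the cops' initial one), `r 1`, … -/
def CopStrategy.cops {G : SimpleGraph V} {k : ℕ} (σ : CopStrategy G k) (r : ℕ → V) (t : ℕ) :
    Fin k → V :=
  σ.pos (history r t)

/-- A turn of the infinite-speed robber from `u` to `v`, while the cops stand at `C`: he follows a
path of `G` of any length (possibly `0`), no vertex of which is occupied by a cop. -/
def RobberMove (G : SimpleGraph V) {k : ℕ} (C : Fin k → V) (u v : V) : Prop :=
  ∃ p : G.Walk u v, p.IsPath ∧ ∀ w ∈ p.support, ∀ i, C i ≠ w

/-- Some cop occupies the robber's vertex `r t`, either when he has arrived there or after the next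
cop turn. -/
def Captured {G : SimpleGraph V} {k : ℕ} (σ : CopStrategy G k) (r : ℕ → V) (t : ℕ) : Prop :=
  ∃ i, σ.cops r t i = r t ∨ σ.cops r (t + 1) i = r t

/-- The robber's positions `r` arise from legal play against `σ`: as long as he has not been
captured, each of his turns is a legal move. (What `r` does after a capture is irrelevant.) -/
def LegalPlay {G : SimpleGraph V} {k : ℕ} (σ : CopStrategy G k) (r : ℕ → V) : Prop :=
  ∀ t, (∀ s ≤ t, ¬ Captured σ r s) → RobberMove G (σ.cops r (t + 1)) (r t) (r (t + 1))

/-- `k` cops can guarantee the capture of an infinite-speed robber on `G`, no matter how he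
plays. -/
def CopsWin (G : SimpleGraph V) (k : ℕ) : Prop :=
  ∃ σ : CopStrategy G k, ∀ r : ℕ → V, LegalPlay σ r → ∃ t, Captured σ r t

/-- The infinite-speed cop number `c_∞(G)` of a finite graph `G`: the minimum number of cops that
can guarantee capture. -/
noncomputable def copNumber (G : SimpleGraph V) : ℕ :=
  sInf {k : ℕ | CopsWin G k}

/-- On a finite graph some number of cops suffices, so the minimum defining `copNumber` exists. -/
theorem exists_copsWin [Finite V] (G : SimpleGraph V) : {k : ℕ | CopsWin G k}.Nonempty := by
  obtain ⟨k, ⟨e⟩⟩ := Finite.exists_equiv_fin V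
  exact ⟨k, ⟨fun _ i => e.symm i, fun _ _ _ => Or.inl rfl⟩, fun r _ =>
    ⟨0, e (r 0), Or.inl (e.symm_apply_apply (r 0))⟩⟩

/-- On a finite graph, `copNumber G` cops can guarantee capture. -/
theorem copsWin_copNumber [Finite V] (G : SimpleGraph V) : CopsWin G (copNumber G) :=
  Nat.sInf_mem (exists_copsWin G)

end InfiniteSpeedGame

/-! The robber keeps to vertices `v` with `totalThreat C v < 1 / 2`. Encode vertices by their
agreement with `v`, so that `v` is the full set, and let him only delete elements, moving away from
`v`. By the local LYM inequality the proportion of a layer that he reaches drops, from one layer to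
the next, by at most the LYM weight of the cops standing there. The threat bounds that weight after
any cop turn, so he reaches more than half of the cube (`one_sub_lymWeight_mul_le_card`,
`two_pow_lt_two_mul_card_robberMove`). Summed over all `v`, one cop's threat is about `2 n ln n`.
With few cops, Markov's inequality leaves at most half of the vertices under threat at least `1 / 2`
(`two_mul_card_totalThreat_le`), so a safe vertex is always within reach. -/

namespace InfiniteSpeedGame

open Finset
open scoped FinsetFamily

/-! ### Evasion strategies from a safety predicate -/

section Evasion

variable {V : Type*} {G : SimpleGraph V} {k : ℕ}

/-- `C'` can be reached from `C` in one cop turn. -/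
def CopMove (G : SimpleGraph V) (C C' : Fin k → V) : Prop :=
  ∀ i, C' i = C i ∨ G.Adj (C i) (C' i)

/-- The robber's past when he chooses each next vertex by the rule `next`. -/
def pastOf (next : List V → V) : ℕ → List V
  | 0 => []
  | t + 1 => next (pastOf next t) :: pastOf next t

theorem history_pastOf (next : List V → V) (t : ℕ) :
    history (fun s => next (pastOf next s)) t = pastOf next t := by
  induction t with
  | zero => rfl
  | succ t ih => simp [history, pastOf, ih]

/-- If the robber can always stay within a family of vertices that are safe from the next cop turn,
then the cops cannot win. -/
theorem not_copsWin_of_safe (Safe : (Fin k → V) → V → Prop)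
    (exists_safe : ∀ C, ∃ v, Safe C v)
    (ne_of_safe : ∀ C v, Safe C v → ∀ C', CopMove G C C' → ∀ i, C' i ≠ v)
    (exists_move : ∀ C v, Safe C v → ∀ C', CopMove G C C' → ∃ w, Safe C' w ∧ RobberMove G C' v w) :
    ¬ CopsWin G k := by
  rintro ⟨σ, hσ⟩
  -- The rule must be defined on every history, including those where safety has failed, hence the
  -- conditional guarantees.
  have key : ∀ h : List V, ∃ w,
      (∀ u h', h = u :: h' → Safe (σ.pos h') u → RobberMove G (σ.pos h) u w) ∧
        ((∀ u h', h = u :: h' → Safe (σ.pos h') u) → Safe (σ.pos h) w) := by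
    rintro (_ | ⟨u, h⟩)
    · obtain ⟨w, hw⟩ := exists_safe (σ.pos [])
      exact ⟨w, by simp, fun _ => hw⟩
    · by_cases hu : Safe (σ.pos h) u
      · obtain ⟨w, hw, hm⟩ := exists_move _ u hu (σ.pos (u :: h)) (σ.legal h u)
        refine ⟨w, ?_, fun _ => hw⟩
        rintro u' h' heq -
        obtain ⟨rfl, rfl⟩ := List.cons.inj heq
        exact hm
      · refine ⟨u, ?_, fun H => absurd (H u h rfl) hu⟩
        rintro u' h' heq hs
        obtain ⟨rfl, rfl⟩ := List.cons.inj heq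
        exact absurd hs hu
  choose next hmove hsafe using key
  set r : ℕ → V := fun t => next (pastOf next t) with hr
  have hcops : ∀ t, σ.cops r t = σ.pos (pastOf next t) := fun t => by
    rw [CopStrategy.cops, hr, history_pastOf]
  have safe : ∀ t, Safe (σ.cops r t) (r t) := by
    intro t
    induction t with
    | zero => rw [hcops]; exact hsafe [] (by simp)
    | succ t ih =>
      rw [hcops]
      refine hsafe _ ?_
      rintro u h' heq
      obtain ⟨rfl, rfl⟩ := List.cons.inj heq
      rw [← hcops]; exact ih
  have hlegal : ∀ t, CopMove G (σ.cops r t) (σ.cops r (t + 1)) := fun t i =>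
    σ.legal (history r t) (r t) i
  obtain ⟨t, i, hi⟩ := hσ r fun t _ => by
    have := hmove (pastOf next (t + 1)) (r t) (pastOf next t) rfl (by rw [← hcops]; exact safe t)
    rw [hcops]; exact this
  rcases hi with hi | hi
  · exact ne_of_safe _ _ (safe t) _ (fun _ => Or.inl rfl) i hi
  · exact ne_of_safe _ _ (safe t) _ (hlegal t) i hi

theorem RobberMove.refl {C : Fin k → V} {v : V} (h : ∀ i, C i ≠ v) : RobberMove G C v v :=
  ⟨.nil, by simp, by simpa using h⟩

theorem RobberMove.step {C : Fin k → V} {v w x : V} (h : RobberMove G C v w) (hwx : G.Adj w x)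
    (hx : ∀ i, C i ≠ x) : RobberMove G C v x := by
  classical
  obtain ⟨p, -, hp⟩ := h
  -- The extended walk may revisit a vertex; bypassing gives a path with no new vertices.
  refine ⟨(p.concat hwx).bypass, SimpleGraph.Walk.bypass_isPath _, fun y hy => ?_⟩
  have := SimpleGraph.Walk.support_bypass_subset_support _ hy
  rw [SimpleGraph.Walk.support_concat] at this
  simp only [List.mem_append, List.mem_singleton] at this
  rcases this with h | rfl
  · exact hp y h
  · exact hx

end Evasion

/-! ### Descending through the Boolean lattice past a few forbidden sets -/

section Descent

variable {α : Type*} [DecidableEq α] [Fintype α] {k : ℕ}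

/-- The total LYM weight of a family of sets. -/
noncomputable def lymWeight (B : Fin k → Finset α) : ℝ :=
  ∑ i, ((Fintype.card α).choose #(B i) : ℝ)⁻¹

/-- Downward induction from the full set: passing to the shadow does not lower the proportion, and
only shadow sets equal to some `B i` can be missing from `R`. -/
theorem one_sub_sum_le_card_slice_div {R : Finset (Finset α)} {B : Fin k → Finset α}
    (huniv : univ ∈ R) (herase : ∀ s ∈ R, ∀ a ∈ s, (∀ i, B i ≠ s.erase a) → s.erase a ∈ R)
    {r : ℕ} (hr : r ≤ Fintype.card α) :
    1 - ∑ i, (if r ≤ #(B i) then ((Fintype.card α).choose #(B i) : ℝ)⁻¹ else 0) ≤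
      #(R.slice r) / (Fintype.card α).choose r := by
  induction hr using Nat.decreasingInduction with
  | self =>
    have h1 : (1 : ℝ) ≤ #(R.slice (Fintype.card α)) := by
      have : 0 < #(R.slice (Fintype.card α)) :=
        card_pos.2 ⟨univ, mem_slice.2 ⟨huniv, card_univ⟩⟩
      exact_mod_cast this
    have h2 : 0 ≤ ∑ i, (if Fintype.card α ≤ #(B i) then
        ((Fintype.card α).choose #(B i) : ℝ)⁻¹ else 0) :=
      sum_nonneg fun i _ => by split_ifs <;> positivity
    rw [Nat.choose_self, Nat.cast_one, div_one]
    linarith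
  | of_succ r hr ih =>
    have hlym := card_div_choose_le_card_shadow_div_choose (𝕜 := ℝ) (Nat.succ_ne_zero r)
      (sized_slice (𝒜 := R) (r := r + 1))
    simp only [Nat.succ_eq_add_one, Nat.add_sub_cancel] at hlym
    have hsub : ∂ (R.slice (r + 1)) ⊆ R.slice r ∪ ({i | #(B i) = r} : Finset (Fin k)).image B := by
      intro t ht
      obtain ⟨s, hs, a, ha, rfl⟩ := mem_shadow_iff.1 ht
      obtain ⟨hsR, hsc⟩ := mem_slice.1 hs
      have hc : #(s.erase a) = r := by rw [card_erase_of_mem ha, hsc, Nat.add_sub_cancel]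
      by_cases h : ∀ i, B i ≠ s.erase a
      · exact mem_union_left _ (mem_slice.2 ⟨herase s hsR a ha h, hc⟩)
      · push Not at h
        obtain ⟨i, hi⟩ := h
        exact mem_union_right _ (mem_image.2 ⟨i, by simp [hi, hc], hi⟩)
    have hcard : (#(∂ (R.slice (r + 1))) : ℝ) ≤
        #(R.slice r) + #({i | #(B i) = r} : Finset (Fin k)) := by
      exact_mod_cast (card_le_card hsub).trans
        ((card_union_le _ _).trans (Nat.add_le_add_left card_image_le _))
    have hpos : (0 : ℝ) < (Fintype.card α).choose r := by
      exact_mod_cast Nat.choose_pos hr.le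
    have hsplit : ∑ i, (if r ≤ #(B i) then ((Fintype.card α).choose #(B i) : ℝ)⁻¹ else 0) =
        ∑ i, (if r + 1 ≤ #(B i) then ((Fintype.card α).choose #(B i) : ℝ)⁻¹ else 0) +
          #({i | #(B i) = r} : Finset (Fin k)) / (Fintype.card α).choose r := by
      rw [div_eq_mul_inv, card_filter, Nat.cast_sum, sum_mul, ← sum_add_distrib]
      refine sum_congr rfl fun i _ => ?_
      rcases lt_trichotomy #(B i) r with h | h | h
      · simp [h.not_ge, h.ne, (h.trans (Nat.lt_succ_self r)).not_ge]
      · simp [h]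
      · simp [h.le, h.ne', Nat.succ_le_of_lt h]
    have := div_le_div_of_nonneg_right hcard hpos.le
    rw [add_div] at this
    linarith

/-- A family closed under deleting elements, except for running into one of the sets `B i`,
contains a proportion of at least `1 - lymWeight B` of all sets. -/
theorem one_sub_lymWeight_mul_le_card {R : Finset (Finset α)} {B : Fin k → Finset α}
    (huniv : univ ∈ R) (herase : ∀ s ∈ R, ∀ a ∈ s, (∀ i, B i ≠ s.erase a) → s.erase a ∈ R) :
    (1 - lymWeight B) * 2 ^ Fintype.card α ≤ #R := by
  have hlayer : ∀ r ∈ range (Fintype.card α + 1),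
      (1 - lymWeight B) * (Fintype.card α).choose r ≤ #(R.slice r) := by
    intro r hr
    have hr' : r ≤ Fintype.card α := Nat.lt_succ_iff.1 (mem_range.1 hr)
    have hpos : (0 : ℝ) < (Fintype.card α).choose r := by exact_mod_cast Nat.choose_pos hr'
    rw [← le_div_iff₀ hpos]
    refine le_trans (sub_le_sub_left (sum_le_sum fun i _ => ?_) 1)
      (one_sub_sum_le_card_slice_div huniv herase hr')
    split_ifs
    · exact le_rfl
    · positivity
  have hsum : ((2 : ℝ) ^ Fintype.card α) =
      ∑ r ∈ range (Fintype.card α + 1), ((Fintype.card α).choose r : ℝ) := by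
    exact_mod_cast (Nat.sum_range_choose _).symm
  have hR : (#R : ℝ) = ∑ r ∈ range (Fintype.card α + 1), (#(R.slice r) : ℝ) := by
    rw [← sum_card_slice R, Nat.cast_sum]
    exact sum_congr (by ext; simp) fun _ _ => rfl
  rw [hsum, hR, mul_sum]
  exact sum_le_sum hlayer

end Descent

/-! ### The hypercube -/

section Hypercube

variable {n k : ℕ}

/-- Vertices of the hypercube, encoded by the set of coordinates in which they agree with `v`. -/
def agreement (v : Fin n → Bool) : (Fin n → Bool) ≃ Finset (Fin n) where
  toFun w := {i | w i = v i}
  invFun s i := if i ∈ s then v i else !v i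
  left_inv w := by
    funext i
    by_cases h : w i = v i
    · simp [h]
    · simpa [h] using (Bool.eq_not_of_ne h).symm
  right_inv s := by
    ext i
    by_cases h : i ∈ s <;> simp [h]

theorem mem_agreement {v w : Fin n → Bool} {i : Fin n} : i ∈ agreement v w ↔ w i = v i := by
  simp [agreement]

theorem hammingDist_add_card_agreement (v w : Fin n → Bool) :
    hammingDist w v + #(agreement v w) = n := by
  have := card_filter_add_card_filter_not (s := (univ : Finset (Fin n))) (fun i => w i = v i)
  rw [card_univ, Fintype.card_fin] at this
  rw [add_comm]
  exact this

theorem choose_card_agreement (v w : Fin n → Bool) :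
    n.choose #(agreement v w) = n.choose (hammingDist w v) :=
  Nat.choose_symm_of_eq_add (by rw [add_comm]; exact (hammingDist_add_card_agreement v w).symm)

theorem hypercube_adj_symm_erase (v : Fin n → Bool) {s : Finset (Fin n)} {a : Fin n} (ha : a ∈ s) :
    (hypercube n).Adj ((agreement v).symm s) ((agreement v).symm (s.erase a)) := by
  change hammingDist _ _ = 1
  rw [hammingDist, card_eq_one]
  refine ⟨a, ?_⟩
  ext i
  by_cases hi : i = a
  · subst hi; simp [agreement, ha]
  · simp [agreement, hi]

theorem sum_hammingDist (g : ℕ → ℝ) (c : Fin n → Bool) :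
    ∑ v, g (hammingDist c v) = ∑ j ∈ range (n + 1), n.choose j * g j := by
  have h : ∑ v, g (hammingDist c v) = ∑ s : Finset (Fin n), g (n - #s) := by
    refine Fintype.sum_equiv (agreement c) _ _ fun v => ?_
    rw [hammingDist_comm, Nat.eq_sub_of_add_eq (hammingDist_add_card_agreement c v)]
  rw [h, ← powerset_univ, sum_powerset_apply_card (fun j => g (n - j)), card_univ,
    Fintype.card_fin, ← sum_range_reflect]
  refine sum_congr rfl fun j hj => ?_
  have hj' : j ≤ n := Nat.lt_succ_iff.1 (mem_range.1 hj)
  rw [nsmul_eq_mul, Nat.add_sub_cancel, Nat.choose_symm hj', Nat.sub_sub_self hj']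

/-- An upper bound for the LYM weight that a cop at distance `j` can have after her next turn. -/
noncomputable def threat (n j : ℕ) : ℝ :=
  (n.choose (j - 1) : ℝ)⁻¹ + (n.choose (min (j + 1) n) : ℝ)⁻¹

/-- By unimodality, a binomial coefficient is at least one of its two neighbours, so the case `i =
j` needs no term of its own. At the ends `0` and `n`, truncation supplies the term. -/
theorem inv_choose_le_threat {i j : ℕ} (hi : i ≤ n) (hj : j ≤ n) (hij : i ≤ j + 1)
    (hji : j ≤ i + 1) : (n.choose i : ℝ)⁻¹ ≤ threat n j := by
  have hanti : ∀ a, a ≤ n → n.choose a ≤ n.choose i → (n.choose i : ℝ)⁻¹ ≤ (n.choose a : ℝ)⁻¹ :=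
    fun a ha h => inv_anti₀ (by exact_mod_cast Nat.choose_pos ha) (by exact_mod_cast h)
  have h1 : (0 : ℝ) ≤ (n.choose (j - 1) : ℝ)⁻¹ := by positivity
  have h2 : (0 : ℝ) ≤ (n.choose (min (j + 1) n) : ℝ)⁻¹ := by positivity
  suffices h : n.choose (j - 1) ≤ n.choose i ∨ n.choose (min (j + 1) n) ≤ n.choose i by
    rw [threat]
    rcases h with h | h
    · linarith [hanti _ (by omega) h]
    · linarith [hanti _ (min_le_right _ _) h]
  obtain rfl | rfl | rfl : i + 1 = j ∨ i = j ∨ i = j + 1 := by omega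
  · exact Or.inl le_rfl
  · rcases Nat.eq_zero_or_pos i with rfl | hi0
    · exact Or.inl le_rfl
    rcases hj.eq_or_lt with rfl | hin
    · exact Or.inr (by simp)
    rw [min_eq_left hin]
    by_cases hc : i ≤ n - i
    · left
      have := Nat.choose_succ_right_eq n (i - 1)
      rw [Nat.sub_add_cancel hi0] at this
      refine Nat.le_of_mul_le_mul_right ?_ hi0
      rw [this]
      exact Nat.mul_le_mul_left _ (by omega)
    · right
      have := Nat.choose_succ_right_eq n i
      refine Nat.le_of_mul_le_mul_right (c := i + 1) ?_ (Nat.succ_pos i)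
      rw [this]
      exact Nat.mul_le_mul_left _ (by omega)
  · exact Or.inr (by rw [min_eq_left hi])

theorem sum_choose_mul_inv_choose_pred (n : ℕ) :
    ∑ j ∈ range (n + 1), (n.choose j : ℝ) * (n.choose (j - 1) : ℝ)⁻¹ =
      1 + ((n + 1) * (harmonic n : ℝ) - n) := by
  rw [sum_range_succ', add_comm]
  congr 1
  · simp
  -- The ratio of consecutive coefficients is `(n - j) / (j + 1) = (n + 1) / (j + 1) - 1`.
  have hterm : ∀ j ∈ range n, (n.choose (j + 1) : ℝ) * (n.choose (j + 1 - 1) : ℝ)⁻¹ =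
      (n + 1) * ((j + 1 : ℕ) : ℝ)⁻¹ - 1 := by
    intro j hj
    have hjn : j < n := mem_range.1 hj
    have hpos : (0 : ℝ) < n.choose j := by exact_mod_cast Nat.choose_pos hjn.le
    have h : (n.choose (j + 1) : ℝ) * (j + 1) = n.choose j * (n - j) := by
      rw [← Nat.cast_sub hjn.le]
      exact_mod_cast Nat.choose_succ_right_eq n j
    rw [Nat.add_sub_cancel]
    push_cast
    field_simp
    linarith
  rw [sum_congr rfl hterm, sum_sub_distrib, ← mul_sum, harmonic]
  simp

theorem sum_choose_mul_threat (n : ℕ) :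
    ∑ j ∈ range (n + 1), (n.choose j : ℝ) * threat n j =
      2 * (1 + ((n + 1) * (harmonic n : ℝ) - n)) := by
  -- The reflection `j ↦ n - j` exchanges the two halves of the threat.
  have hup : ∑ j ∈ range (n + 1), (n.choose j : ℝ) * (n.choose (min (j + 1) n) : ℝ)⁻¹ =
      ∑ j ∈ range (n + 1), (n.choose j : ℝ) * (n.choose (j - 1) : ℝ)⁻¹ := by
    rw [← sum_range_reflect]
    refine sum_congr rfl fun j hj => ?_
    have hj' : j ≤ n := Nat.lt_succ_iff.1 (mem_range.1 hj)
    rw [Nat.add_sub_cancel, Nat.choose_symm hj', ← Nat.choose_symm (k := j - 1) (by omega)]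
    congr 4
    omega
  simp only [threat, mul_add, sum_add_distrib, hup, sum_choose_mul_inv_choose_pred]
  ring

/-- The total threat that cops at `C` pose to `v`. -/
noncomputable def totalThreat (C : Fin k → Fin n → Bool) (v : Fin n → Bool) : ℝ :=
  ∑ i, threat n (hammingDist (C i) v)

theorem threat_nonneg (n j : ℕ) : 0 ≤ threat n j := by
  unfold threat; positivity

theorem sum_totalThreat (C : Fin k → Fin n → Bool) :
    ∑ v, totalThreat C v = k * (2 * (1 + ((n + 1) * (harmonic n : ℝ) - n))) := by
  simp only [totalThreat]
  rw [sum_comm]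
  simp [sum_hammingDist, sum_choose_mul_threat]

theorem inv_choose_hammingDist_le_threat {C C' : Fin k → Fin n → Bool}
    (h : CopMove (hypercube n) C C') (v : Fin n → Bool) (i : Fin k) :
    (n.choose (hammingDist (C' i) v) : ℝ)⁻¹ ≤ threat n (hammingDist (C i) v) := by
  have hle : ∀ w : Fin n → Bool, hammingDist w v ≤ n := fun w => by
    have := hammingDist_add_card_agreement v w
    omega
  have hd : hammingDist (C i) (C' i) ≤ 1 := by
    rcases h i with h | h
    · simp [h]
    · exact le_of_eq h
  have h1 := hammingDist_triangle (C i) (C' i) v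
  have h2 := hammingDist_triangle (C' i) (C i) v
  rw [hammingDist_comm (C' i) (C i)] at h2
  exact inv_choose_le_threat (hle _) (hle _) (by omega) (by omega)

theorem lymWeight_agreement_le_totalThreat {C C' : Fin k → Fin n → Bool}
    (h : CopMove (hypercube n) C C') (v : Fin n → Bool) :
    lymWeight (fun i => agreement v (C' i)) ≤ totalThreat C v := by
  refine sum_le_sum fun i _ => ?_
  rw [Fintype.card_fin, choose_card_agreement]
  exact inv_choose_hammingDist_le_threat h v i

/-- A cop able to step onto `v` alone contributes threat at least `1 / n.choose 0 = 1`. -/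
theorem ne_of_totalThreat_lt {C C' : Fin k → Fin n → Bool} (h : CopMove (hypercube n) C C')
    {v : Fin n → Bool} (hv : totalThreat C v < 1 / 2) (i : Fin k) : C' i ≠ v := by
  intro hi
  have h1 := inv_choose_hammingDist_le_threat h v i
  rw [hi, hammingDist_self, Nat.choose_zero_right, Nat.cast_one, inv_one] at h1
  have h2 : threat n (hammingDist (C i) v) ≤ totalThreat C v :=
    single_le_sum (f := fun i => threat n (hammingDist (C i) v))
      (fun _ _ => threat_nonneg _ _) (mem_univ i)
  linarith

open Classical in
/-- From a vertex under little threat the robber can reach more than half of the hypercube. -/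
theorem two_pow_lt_two_mul_card_robberMove {C C' : Fin k → Fin n → Bool}
    (h : CopMove (hypercube n) C C') {v : Fin n → Bool} (hv : totalThreat C v < 1 / 2) :
    (2 : ℝ) ^ n < 2 * #{w | RobberMove (hypercube n) C' v w} := by
  set R : Finset (Finset (Fin n)) :=
    ({w | RobberMove (hypercube n) C' v w} : Finset _).map (agreement v).toEmbedding with hR
  have hmem : ∀ s, s ∈ R ↔ RobberMove (hypercube n) C' v ((agreement v).symm s) := by
    intro s
    rw [hR, mem_map_equiv]
    simp
  have hcard := one_sub_lymWeight_mul_le_card (R := R) (B := fun i => agreement v (C' i))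
    (by
      have huniv : agreement v v = univ := by ext i; simp [mem_agreement]
      rw [hmem, ← huniv, Equiv.symm_apply_apply]
      exact RobberMove.refl (ne_of_totalThreat_lt h hv))
    (by
      intro s hs a ha hne
      rw [hmem] at hs ⊢
      refine hs.step (hypercube_adj_symm_erase v ha) fun i hi => hne i ?_
      rw [hi, Equiv.apply_symm_apply])
  rw [Fintype.card_fin, hR, card_map] at hcard
  have hlt : lymWeight (fun i => agreement v (C' i)) < 1 / 2 :=
    (lymWeight_agreement_le_totalThreat h v).trans_lt hv
  have hpos : (0 : ℝ) < 2 ^ n := by positivity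
  nlinarith

open Classical in
/-- At most half of the vertices are under a large threat, if there are few cops. -/
theorem two_mul_card_totalThreat_le (C : Fin k → Fin n → Bool)
    (hk : (k : ℝ) * (8 * (1 + ((n + 1) * (harmonic n : ℝ) - n))) ≤ 2 ^ n) :
    2 * (#{v | ¬ totalThreat C v < 1 / 2} : ℝ) ≤ 2 ^ n := by
  have hnonneg : ∀ v, 0 ≤ totalThreat C v := fun v => sum_nonneg fun _ _ => threat_nonneg _ _
  -- Markov's inequality. The `8` in `hk` combines the factor `2` of the threat sum, the threshold
  -- `1 / 2` and the half of the cube.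
  have h : (#{v | ¬ totalThreat C v < 1 / 2} : ℝ) * (1 / 2) ≤ ∑ v, totalThreat C v := by
    rw [← nsmul_eq_mul]
    refine (card_nsmul_le_sum _ (totalThreat C) _ fun v hv => ?_).trans
      (sum_le_sum_of_subset_of_nonneg (subset_univ _) fun v _ _ => hnonneg v)
    exact not_lt.1 (mem_filter.1 hv).2
  rw [sum_totalThreat] at h
  linarith

theorem not_copsWin_hypercube
    (hk : (k : ℝ) * (8 * (1 + ((n + 1) * (harmonic n : ℝ) - n))) ≤ 2 ^ n) :
    ¬ CopsWin (hypercube n) k := by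
  classical
  -- a set of more than half of the vertices contains one under little threat
  have meets : ∀ (C : Fin k → Fin n → Bool) (S : Finset (Fin n → Bool)),
      (2 : ℝ) ^ n < 2 * #S → ∃ w ∈ S, totalThreat C w < 1 / 2 := by
    intro C S hS
    by_contra! hcon
    have hsub : S ⊆ ({v | ¬ totalThreat C v < 1 / 2} : Finset _) := fun w hw => by
      simpa using hcon w hw
    have : (#S : ℝ) ≤ #{v | ¬ totalThreat C v < 1 / 2} := by exact_mod_cast card_le_card hsub
    linarith [two_mul_card_totalThreat_le C hk]
  refine not_copsWin_of_safe (fun C v => totalThreat C v < 1 / 2) (fun C => ?_)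
    (fun C v hv C' h i => ne_of_totalThreat_lt h hv i) fun C v hv C' h => ?_
  · obtain ⟨w, -, hw⟩ := meets C univ (by
      have hpos : (0 : ℝ) < 2 ^ n := by positivity
      simp only [card_univ, Fintype.card_pi, Fintype.card_bool, prod_const, Fintype.card_fin]
      push_cast
      linarith)
    exact ⟨w, hw⟩
  · obtain ⟨w, hw, hs⟩ := meets C' _ (two_pow_lt_two_mul_card_robberMove h hv)
    exact ⟨w, hs, (mem_filter.1 hw).2⟩

end Hypercube

open Filter in
-- As Euler's constant is below `2 / 3`, the left side is at most `n ln n + ln n - n / 3 + 5 / 3`;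
-- `ln n ≤ n / 6` and `n ≥ 10` absorb the rest.
theorem eventually_harmonic_bound :
    ∀ᶠ n : ℕ in atTop, 1 + ((n + 1) * (harmonic n : ℝ) - n) ≤ n * Real.log n := by
  have h1 : ∀ᶠ n : ℕ in atTop, (harmonic n : ℝ) - Real.log n < 2 / 3 :=
    Real.tendsto_harmonic_sub_log.eventually_lt_const Real.eulerMascheroniConstant_lt_two_thirds
  have h2 : ∀ᶠ n : ℕ in atTop, ‖Real.log n‖ ≤ 1 / 6 * ‖(n : ℝ)‖ :=
    tendsto_natCast_atTop_atTop.eventually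
      (Real.isLittleO_log_id_atTop.bound (by norm_num : (0 : ℝ) < 1 / 6))
  filter_upwards [h1, h2, eventually_ge_atTop 10] with n h1 h2 h3
  have h3' : (10 : ℝ) ≤ n := by exact_mod_cast h3
  rw [Real.norm_eq_abs, Real.norm_eq_abs, abs_of_nonneg (by linarith : (0 : ℝ) ≤ n)] at h2
  have h4 := (le_abs_self _).trans h2
  nlinarith [mul_le_mul_of_nonneg_left h1.le (by linarith : (0 : ℝ) ≤ (n : ℝ) + 1)]

end InfiniteSpeedGame

theorem theorem4p3 :
    ∃ N : ℕ, ∀ n : ℕ, N ≤ n →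
      (2 : ℝ) ^ ((n : ℤ) - 3) / ((n : ℝ) * Real.log (n : ℝ)) ≤
        (InfiniteSpeedGame.copNumber (hypercube n) : ℝ) := by
  obtain ⟨N, hN⟩ := Filter.eventually_atTop.1 InfiniteSpeedGame.eventually_harmonic_bound
  -- The `2` makes `Real.log n` positive.
  refine ⟨max N 2, fun n hn => ?_⟩
  have hn2 : (1 : ℝ) < n := by exact_mod_cast (le_max_right N 2).trans hn
  have hpos : 0 < (n : ℝ) * Real.log n := mul_pos (by linarith) (Real.log_pos hn2)
  by_contra! hlt
  refine InfiniteSpeedGame.not_copsWin_hypercube ?_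
    (InfiniteSpeedGame.copsWin_copNumber (hypercube n))
  rw [lt_div_iff₀ hpos, zpow_sub₀ two_ne_zero, zpow_natCast] at hlt
  norm_num at hlt
  have := mul_le_mul_of_nonneg_left (hN n ((le_max_left N 2).trans hn))
    (Nat.cast_nonneg (α := ℝ) (InfiniteSpeedGame.copNumber (hypercube n)))
  linarith
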